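/- All graphs are finite, simple and undirected. An edge-colored graph is a graph in which each edge is assigned a color (the coloring need not be proper). The color degree $\hat d(v)$ of a vertex $v$ is the number of different colors on the edges incident to $v$, and the average color degree of $G$ is $\hat d(G)=\frac{1}{|V(G)|}\sum_{v\in V(G)}\hat d(v)$. A rainbow matching is a matching whose edges have pairwise distinct colors. Let $\widetilde{K_4}$ denote the properly edge-colored complete graph $K_4$ in which the edges of each color form a matching of size $2$ (so exactly three colors are used). Theorem. Let $k\ge 1$ be an integer and let $G$ be an edge-colored graph with $G\ne\widetilde{K_4}$ and $\hat d(G)\ge 2k-1$. If $|V(G)|\ge 4k-4$, then $G$ contains a rainbow matching of size $k$. -/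

import Mathlib

/-! Edge-colored graphs. An edge coloring (not necessarily proper) of a simple graph `G` with colors
in a type `K` is an arbitrary map `C : G.edgeSet → K`. -/

namespace EdgeColored

variable {V : Type*} {G : SimpleGraph V} {K : Type*}

/-- The color degree of a vertex `v`: the number of distinct colors on the edges incident to `v`. -/
noncomputable def colorDegree (C : G.edgeSet → K) (v : V) : ℕ :=
  (C '' {e : G.edgeSet | v ∈ (e : Sym2 V)}).ncard

/-- The average color degree: the sum of all color degrees divided by the number of vertices
(it is `0` for the graph without vertices). -/
noncomputable def averageColorDegree [Fintype V] (C : G.edgeSet → K) : ℚ :=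
  (∑ v : V, (colorDegree C v : ℚ)) / (Fintype.card V : ℚ)

/-- The edge coloring is proper: two distinct edges with a common endpoint have different colors. -/
def IsProper (C : G.edgeSet → K) : Prop :=
  ∀ (e f : G.edgeSet) (v : V), e ≠ f → v ∈ (e : Sym2 V) → v ∈ (f : Sym2 V) → C e ≠ C f

/-- The exceptional edge-colored graph: a properly edge-colored complete graph on four vertices in
which the edges of each color that occurs form a matching of size two (the three perfect matchings
of the complete graph are the color classes). -/
def IsTildeK4 (C : G.edgeSet → K) : Prop :=
  Nat.card V = 4 ∧ G = ⊤ ∧ IsProper C ∧ ∀ e : G.edgeSet, {f : G.edgeSet | C f = C e}.ncard = 2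

/-- A rainbow matching: a matching of `G` whose edges have pairwise distinct colors. -/
def IsRainbowMatching (C : G.edgeSet → K) (M : G.Subgraph) : Prop :=
  M.IsMatching ∧
    ∀ e f : G.edgeSet, (e : Sym2 V) ∈ M.edgeSet → (f : Sym2 V) ∈ M.edgeSet → C e = C f → e = f

end EdgeColored

/-! Put `k = m + 1` and induct on `m`, over all vertex sets `W` of average color degree at least `2m
+ 1` inside `W` (`exists_isRainbow`). Deleting a vertex `v` of maximum color degree leaves enough
average degree for a rainbow matching `M` that misses `v` and is one edge short.

Suppose that no rainbow matching has one edge more, and call a color free if `M` does not use it.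
Exchange arguments bound the number of free colors sent from the uncovered vertices to an edge of
`M`, and limit which colors of `M` occur between uncovered vertices. Summing color degrees over `W`
then makes every bound an equality (`IsRainbow.sharp_of_maximal`): with `m` now the size of `M`, `W`
has `4m` vertices, and `v` has color degree `3m` and sends a free color to every covered vertex.

If `M` has at least two edges, two exchanges give a matching of the same size that still misses `v`
but uses the color of an edge from `v` to a vertex it covers, contradicting sharpness
(`IsRainbow.exists_larger`). With one edge and four vertices, the only obstruction is the
exceptional `K4` (`isTildeK4_of_forall_card_ne_two`). -/

namespace EdgeColored

open Finset

set_option linter.unusedSectionVars false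

/-! ### Rainbow matchings as families of colored edges, and exchanges. -/

section PartialColoring

variable {V K : Type*} [DecidableEq V] [DecidableEq K]

/-- The set of colors on the edges joining `v` to a vertex of `A`, where `col u w` is the color of
the edge `uw`, or `none` if `u` and `w` are not adjacent. -/
def colorsTo (col : V → V → Option K) (A : Finset V) (v : V) : Finset K :=
  A.biUnion fun w => (col v w).toFinset

/-- The endpoints of a family of colored edges. -/
def endpoints (M : Finset (V × V × K)) : Finset V :=
  M.biUnion fun e => {e.1, e.2.1}

/-- The colors of a family of colored edges. -/
def edgeColors (M : Finset (V × V × K)) : Finset K :=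
  M.image fun e => e.2.2

/-- A rainbow matching with endpoints in `W`, as a family of triples (endpoint, endpoint, color). -/
structure IsRainbow (col : V → V → Option K) (W : Finset V) (M : Finset (V × V × K)) : Prop where
  left_mem : ∀ e ∈ M, e.1 ∈ W
  right_mem : ∀ e ∈ M, e.2.1 ∈ W
  col_eq : ∀ e ∈ M, col e.1 e.2.1 = some e.2.2
  ends_disjoint : ∀ e ∈ M, ∀ f ∈ M, e ≠ f →
    Disjoint ({e.1, e.2.1} : Finset V) {f.1, f.2.1}
  color_inj : ∀ e ∈ M, ∀ f ∈ M, e.2.2 = f.2.2 → e = f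

variable {col : V → V → Option K} {W A B : Finset V} {M : Finset (V × V × K)} {v w x y : V} {a : K}

lemma mem_colorsTo : a ∈ colorsTo col A v ↔ ∃ w ∈ A, col v w = some a := by
  simp [colorsTo]

lemma card_colorsTo_le : (colorsTo col A v).card ≤ A.card := by
  refine (card_biUnion_le_card_mul _ _ 1 fun w _ => ?_).trans (by simp)
  cases col v w <;> simp

lemma mem_endpoints : w ∈ endpoints M ↔ ∃ e ∈ M, w = e.1 ∨ w = e.2.1 := by
  simp [endpoints]

lemma mem_edgeColors : a ∈ edgeColors M ↔ ∃ e ∈ M, e.2.2 = a := by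
  simp [edgeColors]

lemma IsRainbow.mono (h : IsRainbow col A M) (hAB : A ⊆ B) : IsRainbow col B M :=
  ⟨fun e he => hAB (h.left_mem e he), fun e he => hAB (h.right_mem e he), h.col_eq,
    h.ends_disjoint, h.color_inj⟩

lemma IsRainbow.subset (h : IsRainbow col W M) {N : Finset (V × V × K)} (hN : N ⊆ M) :
    IsRainbow col W N :=
  ⟨fun e he => h.left_mem e (hN he), fun e he => h.right_mem e (hN he),
    fun e he => h.col_eq e (hN he), fun e he f hf => h.ends_disjoint e (hN he) f (hN hf),
    fun e he f hf => h.color_inj e (hN he) f (hN hf)⟩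

lemma IsRainbow.insert_edge (h : IsRainbow col W M) (hx : x ∈ W) (hy : y ∈ W)
    (hxM : x ∉ endpoints M) (hyM : y ∉ endpoints M) (hc : col x y = some a)
    (ha : a ∉ edgeColors M) : IsRainbow col W (insert (x, y, a) M) := by
  simp only [mem_endpoints, mem_edgeColors, not_exists, not_and, not_or] at hxM hyM ha
  obtain ⟨h1, h2, h3, h4, h5⟩ := h
  constructor
  · simpa [hx] using fun a b c => h1 (a, b, c)
  · simpa [hy] using fun a b c => h2 (a, b, c)
  · simpa [hc] using fun a b c => h3 (a, b, c)
  · intro e he f hf hef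
    rcases mem_insert.1 he with rfl | he <;> rcases mem_insert.1 hf with rfl | hf
    · exact absurd rfl hef
    · simp only [disjoint_left, mem_insert, mem_singleton]; grind
    · simp only [disjoint_left, mem_insert, mem_singleton]; grind
    · exact h4 e he f hf hef
  · intro e he f hf hef
    rcases mem_insert.1 he with rfl | he <;> rcases mem_insert.1 hf with rfl | hf
    · rfl
    · exact absurd hef.symm (ha f hf)
    · exact absurd hef (ha e he)
    · exact h5 e he f hf hef

lemma card_insert_of_notMem_edgeColors (ha : a ∉ edgeColors M) :
    (insert (x, y, a) M).card = M.card + 1 :=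
  card_insert_of_notMem fun h => ha (mem_edgeColors.2 ⟨_, h, rfl⟩)

lemma endpoints_insert : endpoints (insert (x, y, a) M) = {x, y} ∪ endpoints M := by
  simp [endpoints]

lemma edgeColors_insert : edgeColors (insert (x, y, a) M) = insert a (edgeColors M) := by
  simp [edgeColors]

lemma IsRainbow.card_edgeColors (h : IsRainbow col W M) : (edgeColors M).card = M.card :=
  card_image_of_injOn fun e he f hf => h.color_inj e he f hf

lemma IsRainbow.endpoints_subset (h : IsRainbow col W M) : endpoints M ⊆ W := by
  intro w hw
  obtain ⟨e, he, rfl | rfl⟩ := mem_endpoints.1 hw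
  exacts [h.left_mem e he, h.right_mem e he]

lemma IsRainbow.left_ne_right (hirr : ∀ u, col u u = none) (h : IsRainbow col W M)
    {e : V × V × K} (he : e ∈ M) : e.1 ≠ e.2.1 := by
  intro heq
  have := h.col_eq e he
  rw [← heq, hirr] at this
  simp at this

lemma IsRainbow.card_endpoints (hirr : ∀ u, col u u = none) (h : IsRainbow col W M) :
    (endpoints M).card = 2 * M.card := by
  rw [endpoints, card_biUnion fun e he f hf => h.ends_disjoint e he f hf,
    sum_congr rfl fun e he => card_pair (h.left_ne_right hirr he)]
  simp [mul_comm]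

lemma IsRainbow.notMem_endpoints_erase (h : IsRainbow col W M) {e : V × V × K} (he : e ∈ M) :
    e.1 ∉ endpoints (M.erase e) ∧ e.2.1 ∉ endpoints (M.erase e) := by
  constructor <;>
  · intro hw
    obtain ⟨f, hf, hw⟩ := mem_endpoints.1 hw
    have := h.ends_disjoint e he f (mem_of_mem_erase hf) (ne_of_mem_erase hf).symm
    simp only [disjoint_left, mem_insert, mem_singleton] at this
    grind

lemma IsRainbow.notMem_edgeColors_erase (h : IsRainbow col W M) {e : V × V × K} (he : e ∈ M) :
    e.2.2 ∉ edgeColors (M.erase e) := by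
  intro hw
  obtain ⟨f, hf, hw⟩ := mem_edgeColors.1 hw
  exact ne_of_mem_erase hf (h.color_inj f (mem_of_mem_erase hf) e he hw)

lemma endpoints_mono {N : Finset (V × V × K)} (h : N ⊆ M) : endpoints N ⊆ endpoints M :=
  biUnion_subset_biUnion_of_subset_left _ h

lemma edgeColors_mono {N : Finset (V × V × K)} (h : N ⊆ M) : edgeColors N ⊆ edgeColors M :=
  image_subset_image h

/-- Two independent edges of different colors may replace an edge of a rainbow matching if their
colors and endpoints are not used by the other edges. -/
lemma IsRainbow.exists_exchange (h : IsRainbow col W M) {e : V × V × K} (he : e ∈ M)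
    {x y x' y' : V} {a b : K} (hx : x ∈ W) (hy : y ∈ W) (hx' : x' ∈ W) (hy' : y' ∈ W)
    (hxM : x ∉ endpoints (M.erase e)) (hyM : y ∉ endpoints (M.erase e))
    (hxM' : x' ∉ endpoints (M.erase e)) (hyM' : y' ∉ endpoints (M.erase e))
    (hxx : x ≠ x') (hxy : x ≠ y') (hyx : y ≠ x') (hyy : y ≠ y')
    (hc : col x y = some a) (hc' : col x' y' = some b)
    (ha : a ∉ edgeColors (M.erase e)) (hb : b ∉ edgeColors (M.erase e)) (hab : a ≠ b) :
    ∃ N, IsRainbow col W N ∧ N.card = M.card + 1 := by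
  have hb' : b ∉ edgeColors (insert (x, y, a) (M.erase e)) := by
    rw [edgeColors_insert]; simp [hb, hab.symm]
  refine ⟨insert (x', y', b) (insert (x, y, a) (M.erase e)),
    ((h.subset (erase_subset _ _)).insert_edge hx hy hxM hyM hc ha).insert_edge
      hx' hy' ?_ ?_ hc' hb', ?_⟩
  · rw [endpoints_insert]; simp [hxM', hxx.symm, hyx.symm]
  · rw [endpoints_insert]; simp [hyM', hxy.symm, hyy.symm]
  · rw [card_insert_of_notMem_edgeColors hb', card_insert_of_notMem_edgeColors ha,
      card_erase_add_one he]

end PartialColoring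


/-! ### Counting free colors around a maximal rainbow matching. -/

section Counting

variable {V K : Type*} [DecidableEq V] [DecidableEq K]

/-- The colors not used by `M` on the edges joining `u` to the endpoints of `e`. -/
def freeColors (col : V → V → Option K) (M : Finset (V × V × K)) (e : V × V × K) (u : V) :
    Finset K :=
  colorsTo col {e.1, e.2.1} u \ edgeColors M

/-- The vertices of `W` not covered by `M` that are joined to `e` by an edge whose color is not
used by `M`. -/
def freeNeighbors (col : V → V → Option K) (W : Finset V) (M : Finset (V × V × K))
    (e : V × V × K) : Finset V :=
  {u ∈ W \ endpoints M | (freeColors col M e u).Nonempty}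

variable {col : V → V → Option K} {W : Finset V} {M : Finset (V × V × K)} {e : V × V × K}
  {u u' v w : V} {a b : K}

lemma mem_freeColors : a ∈ freeColors col M e u ↔
    (col u e.1 = some a ∨ col u e.2.1 = some a) ∧ a ∉ edgeColors M := by
  simp [freeColors, mem_colorsTo]

lemma mem_freeNeighbors : u ∈ freeNeighbors col W M e ↔
    (u ∈ W ∧ u ∉ endpoints M) ∧
      ∃ a, (col u e.1 = some a ∨ col u e.2.1 = some a) ∧ a ∉ edgeColors M := by
  rw [freeNeighbors, mem_filter, mem_sdiff]
  simp only [Finset.Nonempty, mem_freeColors]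

lemma card_freeColors_le : (freeColors col M e u).card ≤ 2 :=
  (card_le_card sdiff_subset).trans (card_colorsTo_le.trans card_le_two)

lemma exists_of_two_le_card_freeColors (h : 2 ≤ (freeColors col M e u).card) :
    ∃ a b, col u e.1 = some a ∧ col u e.2.1 = some b ∧ a ≠ b ∧
      a ∉ edgeColors M ∧ b ∉ edgeColors M := by
  obtain ⟨a, ha, b, hb, hab⟩ := one_lt_card.1 h
  rw [mem_freeColors] at ha hb
  obtain ⟨ha | ha, ha'⟩ := ha <;> obtain ⟨hb | hb, hb'⟩ := hb
  · exact absurd (Option.some.inj (ha.symm.trans hb)) hab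
  · exact ⟨a, b, ha, hb, hab, ha', hb'⟩
  · exact ⟨b, a, hb, ha, hab.symm, hb', ha'⟩
  · exact absurd (Option.some.inj (ha.symm.trans hb)) hab

lemma IsRainbow.color_mem_of_maximal (h : IsRainbow col W M)
    (hno : ∀ N, IsRainbow col W N → N.card ≠ M.card + 1)
    (hu : u ∈ W) (huM : u ∉ endpoints M) (hw : w ∈ W) (hwM : w ∉ endpoints M)
    (hc : col u w = some a) : a ∈ edgeColors M := by
  by_contra ha
  exact hno _ (h.insert_edge hu hw huM hwM hc ha) (card_insert_of_notMem_edgeColors ha)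

/-- Were the colors different, the two edges, which are disjoint, could replace `e` and enlarge the
matching. -/
lemma IsRainbow.free_color_eq (h : IsRainbow col W M)
    (hno : ∀ N, IsRainbow col W N → N.card ≠ M.card + 1) (hirr : ∀ u, col u u = none)
    (he : e ∈ M) (hu : u ∈ W) (huM : u ∉ endpoints M) (hu' : u' ∈ W) (hu'M : u' ∉ endpoints M)
    (huu : u ≠ u') (hc : col u e.1 = some a) (hc' : col u' e.2.1 = some b)
    (ha : a ∉ edgeColors M) (hb : b ∉ edgeColors M) : a = b := by
  by_contra hab
  have hsub : M.erase e ⊆ M := erase_subset _ _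
  have h1 : e.1 ∈ endpoints M := mem_endpoints.2 ⟨e, he, .inl rfl⟩
  have h2 : e.2.1 ∈ endpoints M := mem_endpoints.2 ⟨e, he, .inr rfl⟩
  obtain ⟨N, hN, hN'⟩ := h.exists_exchange he hu (h.left_mem e he) hu' (h.right_mem e he)
    (fun h => huM (endpoints_mono hsub h)) (h.notMem_endpoints_erase he).1
    (fun h => hu'M (endpoints_mono hsub h)) (h.notMem_endpoints_erase he).2 huu
    (fun h => huM (h ▸ h2)) (fun h => hu'M (h ▸ h1)) (h.left_ne_right hirr he) hc hc'
    (fun h => ha (edgeColors_mono hsub h)) (fun h => hb (edgeColors_mono hsub h)) hab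
  exact hno N hN hN'

/-- The edge `uw` can take over the color of `e`; a free edge from a third vertex to `e` could then
be added as well. -/
lemma IsRainbow.freeNeighbors_subset (h : IsRainbow col W M)
    (hno : ∀ N, IsRainbow col W N → N.card ≠ M.card + 1)
    (he : e ∈ M) (hu : u ∈ W) (huM : u ∉ endpoints M) (hw : w ∈ W) (hwM : w ∉ endpoints M)
    (hc : col u w = some e.2.2) : freeNeighbors col W M e ⊆ {u, w} := by
  intro t ht
  obtain ⟨⟨ht, htM⟩, a, hta, ha⟩ := mem_freeNeighbors.1 ht
  by_contra htuw
  simp only [mem_insert, mem_singleton, not_or] at htuw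
  have hsub : M.erase e ⊆ M := erase_subset _ _
  have h1 : e.1 ∈ endpoints M := mem_endpoints.2 ⟨e, he, .inl rfl⟩
  have h2 : e.2.1 ∈ endpoints M := mem_endpoints.2 ⟨e, he, .inr rfl⟩
  have hae : e.2.2 ≠ a := fun h => ha (mem_edgeColors.2 ⟨e, he, h⟩)
  have key : ∀ z ∈ W, z ∈ endpoints M → z ∉ endpoints (M.erase e) → col t z = some a → False := by
    intro z hz hzM hzM' htz
    obtain ⟨N, hN, hN'⟩ := h.exists_exchange he hu hw ht hz
      (fun h => huM (endpoints_mono hsub h)) (fun h => hwM (endpoints_mono hsub h))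
      (fun h => htM (endpoints_mono hsub h)) hzM' (Ne.symm htuw.1) (fun h => huM (h ▸ hzM))
      (Ne.symm htuw.2) (fun h => hwM (h ▸ hzM)) hc htz (h.notMem_edgeColors_erase he)
      (fun h => ha (edgeColors_mono hsub h)) hae
    exact hno N hN hN'
  rcases hta with hta | hta
  · exact key _ (h.left_mem e he) h1 (h.notMem_endpoints_erase he).1 hta
  · exact key _ (h.right_mem e he) h2 (h.notMem_endpoints_erase he).2 hta

lemma sum_card_freeColors_eq :
    ∑ u ∈ W \ endpoints M, (freeColors col M e u).card =
      ∑ u ∈ freeNeighbors col W M e, (freeColors col M e u).card := by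
  rw [freeNeighbors, sum_filter_of_ne]
  intro u _ hu
  exact card_pos.1 (Nat.pos_of_ne_zero hu)

lemma sum_card_freeColors_le_four (h : (freeNeighbors col W M e).card ≤ 2) :
    ∑ u ∈ W \ endpoints M, (freeColors col M e u).card ≤ 4 := by
  rw [sum_card_freeColors_eq]
  refine (sum_le_card_nsmul _ _ 2 fun u _ => card_freeColors_le).trans ?_
  simp only [smul_eq_mul]; omega

lemma IsRainbow.sum_card_freeColors_le (h : IsRainbow col W M)
    (hno : ∀ N, IsRainbow col W N → N.card ≠ M.card + 1) (hirr : ∀ u, col u u = none)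
    (he : e ∈ M) (hT : 2 < (freeNeighbors col W M e).card) :
    ∑ u ∈ W \ endpoints M, (freeColors col M e u).card ≤ (W \ endpoints M).card + 1 := by
  -- Two vertices with two free colors each would see the same two colors, crosswise at the ends of
  -- `e`. A third free neighbor then forces these two colors to agree.
  set D := (W \ endpoints M).filter fun u => 2 ≤ (freeColors col M e u).card with hD
  have hD1 : D.card ≤ 1 := by
    rw [card_le_one]
    intro u hu u' hu'
    by_contra huu
    simp only [hD, mem_filter, mem_sdiff] at hu hu'
    obtain ⟨⟨hu, huM⟩, hu2⟩ := hu
    obtain ⟨⟨hu', hu'M⟩, hu'2⟩ := hu'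
    obtain ⟨a, b, ha, hb, hab, haM, hbM⟩ := exists_of_two_le_card_freeColors hu2
    obtain ⟨a', b', ha', hb', hab', haM', hbM'⟩ := exists_of_two_le_card_freeColors hu'2
    obtain ⟨t, ht, htu⟩ := exists_mem_notMem_of_card_lt_card
      (lt_of_le_of_lt (card_le_two (a := u) (b := u')) hT)
    simp only [mem_insert, mem_singleton, not_or] at htu
    obtain ⟨⟨ht, htM⟩, c, htc, hc⟩ := mem_freeNeighbors.1 ht
    have e1 := h.free_color_eq hno hirr he hu huM hu' hu'M huu ha hb' haM hbM'
    rcases htc with htc | htc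
    · exact hab' ((h.free_color_eq hno hirr he hu' hu'M hu huM (Ne.symm huu) ha' hb haM' hbM).trans
        ((h.free_color_eq hno hirr he ht htM hu huM htu.1 htc hb hc hbM).symm.trans
          (h.free_color_eq hno hirr he ht htM hu' hu'M htu.2 htc hb' hc hbM')))
    · exact hab' ((h.free_color_eq hno hirr he hu' hu'M ht htM (Ne.symm htu.2) ha' htc haM' hc).trans
        ((h.free_color_eq hno hirr he hu huM ht htM (Ne.symm htu.1) ha htc haM hc).symm.trans e1))
  calc ∑ u ∈ W \ endpoints M, (freeColors col M e u).card
      ≤ ∑ u ∈ W \ endpoints M, (1 + if 2 ≤ (freeColors col M e u).card then 1 else 0) := by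
        refine sum_le_sum fun u _ => ?_
        have := card_freeColors_le (col := col) (M := M) (e := e) (u := u)
        split_ifs <;> omega
    _ = (W \ endpoints M).card + D.card := by
        rw [sum_add_distrib, hD, card_filter]; simp
    _ ≤ _ := by omega

/-- The edges of `M` with at most two free neighbors. -/
def sparseEdges (col : V → V → Option K) (W : Finset V) (M : Finset (V × V × K)) :
    Finset (V × V × K) :=
  {e ∈ M | (freeNeighbors col W M e).card ≤ 2}

lemma IsRainbow.sum_uncovered_le (h : IsRainbow col W M)
    (hno : ∀ N, IsRainbow col W N → N.card ≠ M.card + 1) :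
    ∑ u ∈ W \ endpoints M, (colorsTo col W u).card ≤
      M.card * (W \ endpoints M).card +
        ∑ e ∈ M, ∑ u ∈ W \ endpoints M, (freeColors col M e u).card := by
  rw [sum_comm, mul_comm, ← smul_eq_mul, ← sum_const, ← sum_add_distrib]
  refine sum_le_sum fun u hu => ?_
  rw [mem_sdiff] at hu
  have hsub : colorsTo col W u ⊆ edgeColors M ∪ M.biUnion fun e => freeColors col M e u := by
    intro a ha
    obtain ⟨w, hw, hc⟩ := mem_colorsTo.1 ha
    by_cases haM : a ∈ edgeColors M
    · exact mem_union_left _ haM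
    by_cases hwM : w ∈ endpoints M
    · obtain ⟨e, he, hwe⟩ := mem_endpoints.1 hwM
      refine mem_union_right _ (mem_biUnion.2 ⟨e, he, mem_freeColors.2 ⟨?_, haM⟩⟩)
      rcases hwe with rfl | rfl
      exacts [.inl hc, .inr hc]
    · exact absurd (h.color_mem_of_maximal hno hu.1 hu.2 hw hwM hc) haM
  refine (card_le_card hsub).trans ((card_union_le _ _).trans ?_)
  rw [h.card_edgeColors]
  exact Nat.add_le_add_left card_biUnion_le _

/-- By maximality, an edge from `v` to an uncovered vertex carries the color of some `e ∈ M`, and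
`freeNeighbors_subset` makes that `e` sparse. -/
lemma IsRainbow.colorsTo_subset (h : IsRainbow col W M)
    (hno : ∀ N, IsRainbow col W N → N.card ≠ M.card + 1)
    (hv : v ∈ W) (hvM : v ∉ endpoints M) :
    colorsTo col W v ⊆
      colorsTo col (endpoints M) v ∪ edgeColors (sparseEdges col W M) := by
  intro a ha
  obtain ⟨w, hw, hc⟩ := mem_colorsTo.1 ha
  by_cases hwM : w ∈ endpoints M
  · exact mem_union_left _ (mem_colorsTo.2 ⟨w, hwM, hc⟩)
  · obtain ⟨e, he, rfl⟩ := mem_edgeColors.1 (h.color_mem_of_maximal hno hv hvM hw hwM hc)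
    refine mem_union_right _ (mem_edgeColors.2 ⟨e, mem_filter.2 ⟨he, ?_⟩, rfl⟩)
    exact (card_le_card (h.freeNeighbors_subset hno he hv hvM hw hwM hc)).trans card_le_two

/-- If the color degrees in `W` have average at least `2 * M.card + 1`, the rainbow matching `M`
misses a vertex `v` of maximum color degree and no rainbow matching is larger, then all the
estimates are sharp. -/
lemma IsRainbow.sharp_of_maximal (hsymm : ∀ u w, col u w = col w u) (hirr : ∀ u, col u u = none)
    (h : IsRainbow col W M) (hno : ∀ N, IsRainbow col W N → N.card ≠ M.card + 1)
    (hM : 1 ≤ M.card) (hW : 4 * M.card ≤ W.card)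
    (hsum : (2 * M.card + 1) * W.card ≤ ∑ w ∈ W, (colorsTo col W w).card)
    (hv : v ∈ W) (hvM : v ∉ endpoints M)
    (hmax : ∀ w ∈ W, (colorsTo col W w).card ≤ (colorsTo col W v).card) :
    W.card = 4 * M.card ∧ (colorsTo col W v).card = 3 * M.card ∧
      (∀ w ∈ endpoints M, (colorsTo col W w).card = 3 * M.card) ∧
      (∀ w ∈ endpoints M, ∃ a, col v w = some a ∧ a ∉ edgeColors M) ∧
      ∀ e ∈ M, ∃ u ∈ W, u ∉ endpoints M ∧ u ≠ v ∧ col e.2.1 u = col v e.1 := by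
  set S := sparseEdges col W M with hS
  have hSM : S ⊆ M := filter_subset _ _
  have hScard : S.card ≤ M.card := card_le_card hSM
  set r := (W \ endpoints M).card with hr
  have hend := h.card_endpoints hirr
  have hrW : r + 2 * M.card = W.card := by
    rw [hr, ← hend, card_sdiff_add_card_eq_card h.endpoints_subset]
  set d := fun w => (colorsTo col W w).card with hd
  have hdv : d v ≤ (colorsTo col (endpoints M) v \ edgeColors M).card + M.card := by
    rw [← h.card_edgeColors]
    refine (card_le_card ?_).trans (card_union_le _ _)
    rw [sdiff_union_self_eq_union]
    exact (h.colorsTo_subset hno hv hvM).trans (union_subset_union_right (edgeColors_mono hSM))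
  have hdv' : d v ≤ 2 * M.card + S.card := by
    refine (card_le_card (h.colorsTo_subset hno hv hvM)).trans ((card_union_le _ _).trans ?_)
    rw [(h.subset hSM).card_edgeColors, ← hend]
    exact Nat.add_le_add_right card_colorsTo_le _
  have hsplit : ∑ w ∈ W, d w = ∑ u ∈ W \ endpoints M, d u + ∑ w ∈ endpoints M, d w :=
    (sum_sdiff h.endpoints_subset).symm
  have hcov : ∑ w ∈ endpoints M, d w ≤ 2 * M.card * d v := by
    rw [← hend, ← smul_eq_mul]
    exact sum_le_card_nsmul _ _ _ fun w hw => hmax w (h.endpoints_subset hw)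
  set f := fun e => ∑ u ∈ W \ endpoints M, (freeColors col M e u).card with hf
  have hunc : ∑ u ∈ W \ endpoints M, d u ≤ M.card * r + ∑ e ∈ M, f e := h.sum_uncovered_le hno
  have hf4 : ∀ e ∈ S, f e ≤ 4 := fun e he => sum_card_freeColors_le_four (mem_filter.1 he).2
  have hfsum : ∑ e ∈ M, f e ≤ (M.card - S.card) * (r + 1) + S.card * 4 := by
    rw [← sum_sdiff hSM, ← card_sdiff_of_subset hSM]
    refine Nat.add_le_add (sum_le_card_nsmul _ _ _ fun e he => ?_) (sum_le_card_nsmul _ _ _ hf4)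
    rw [mem_sdiff, hS, sparseEdges, mem_filter, not_and, not_le] at he
    exact h.sum_card_freeColors_le hno hirr he.1 (he.2 he.1)
  obtain ⟨q, hq⟩ := Nat.exists_eq_add_of_le hScard
  have hq' : M.card - S.card = q := by omega
  rw [hq'] at hfsum
  have hr2 : 2 * M.card ≤ r := by omega
  -- The last three terms bound the used colors at uncovered vertices, the free colors there, and
  -- the color degrees of covered vertices.
  have htot : (2 * M.card + 1) * (r + 2 * M.card) ≤
      M.card * r + (q * (r + 1) + S.card * 4) + 2 * M.card * (2 * M.card + S.card) := by
    rw [hrW]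
    calc _ ≤ _ := hsum
      _ = _ := hsplit
      _ ≤ _ := by
        have := Nat.mul_le_mul_left (2 * M.card) hdv'
        omega
  -- With `s = S.card` and `m = M.card`, `htot` says `(s + 1) * r + m ≤ (2 * m + 3) * s`; since `r ≥
  -- 2 * m`, this gives `m ≤ s`.
  have hq0 : q = 0 := by
    rw [hq] at htot hr2
    have := Nat.mul_le_mul_left (S.card + 1) hr2
    nlinarith
  have hSMeq : S = M := eq_of_subset_of_card_le hSM (by omega)
  subst hq0
  have hr' : r = 2 * M.card := by
    rw [hSMeq] at htot
    nlinarith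
  rw [hSMeq] at htot hfsum hdv' hf4
  rw [← hrW, hsplit] at hsum
  have hdv3 : d v = 3 * M.card := by
    rw [hr'] at hsum hunc
    nlinarith
  have hcov' : ∑ w ∈ endpoints M, d v ≤ ∑ w ∈ endpoints M, d w := by
    rw [sum_const, smul_eq_mul, hend, hdv3]
    rw [hr'] at hsum hunc
    nlinarith
  have hfsum' : ∑ e ∈ M, 4 ≤ ∑ e ∈ M, f e := by
    rw [sum_const, smul_eq_mul]
    rw [hdv3] at hcov
    rw [hr'] at hsum hunc
    nlinarith
  have hfree : ∀ w ∈ endpoints M, ∃ a, col v w = some a ∧ a ∉ edgeColors M := by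
    intro w hw
    by_contra! hcon
    -- Without a free edge to `w`, the free colors at `v` come from `2 * M.card - 1` vertices, too
    -- few for color degree `3 * M.card`.
    have hsub : colorsTo col (endpoints M) v \ edgeColors M ⊆
        colorsTo col ((endpoints M).erase w) v := by
      intro a ha
      obtain ⟨ha, haM⟩ := mem_sdiff.1 ha
      obtain ⟨w', hw', hc⟩ := mem_colorsTo.1 ha
      refine mem_colorsTo.2 ⟨w', mem_erase.2 ⟨?_, hw'⟩, hc⟩
      rintro rfl
      exact haM (hcon a hc)
    have := (card_le_card hsub).trans card_colorsTo_le
    rw [card_erase_of_mem hw] at this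
    omega
  refine ⟨by omega, hdv3, fun w hw => ?_, hfree, fun e he => ?_⟩
  · rw [← hdv3]
    exact (sum_eq_sum_iff_of_le fun w hw => hmax w (h.endpoints_subset hw)).1
      (le_antisymm (sum_le_sum fun w hw => hmax w (h.endpoints_subset hw)) hcov') w hw
  · have hfe : f e = 4 :=
      (sum_eq_sum_iff_of_le hf4).1 (le_antisymm (sum_le_sum hf4) hfsum') e he
    have hTe : (freeNeighbors col W M e).card ≤ 2 := by
      rw [← hSMeq] at he
      exact (mem_filter.1 he).2
    obtain ⟨a, ha, haM⟩ := hfree e.1 (mem_endpoints.2 ⟨e, he, .inl rfl⟩)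
    have hvT : v ∈ freeNeighbors col W M e := mem_freeNeighbors.2 ⟨⟨hv, hvM⟩, a, .inl ha, haM⟩
    rw [hf] at hfe
    simp only [sum_card_freeColors_eq, ← add_sum_erase _ _ hvT] at hfe
    have hv2 := card_freeColors_le (col := col) (M := M) (e := e) (u := v)
    have hT1 : ((freeNeighbors col W M e).erase v).card ≤ 1 := by
      rw [card_erase_of_mem hvT]; omega
    -- The total 4 is attained by at most two free neighbors with at most two free colors each; `v`
    -- accounts for at most 2, so the other has two.
    obtain ⟨u, hu, hu2⟩ : ∃ u ∈ (freeNeighbors col W M e).erase v,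
        2 ≤ (freeColors col M e u).card := by
      by_contra! hcon
      have := sum_le_card_nsmul ((freeNeighbors col W M e).erase v)
        (fun u => (freeColors col M e u).card) 1 fun u hu => by have := hcon u hu; omega
      rw [smul_eq_mul] at this
      omega
    obtain ⟨huv, hu⟩ := mem_erase.1 hu
    obtain ⟨⟨huW, huM⟩, -⟩ := mem_freeNeighbors.1 hu
    obtain ⟨c, b, hc, hb, -, hcM, hbM⟩ := exists_of_two_le_card_freeColors hu2
    refine ⟨u, huW, huM, huv, ?_⟩
    rw [hsymm, hb, ha, h.free_color_eq hno hirr he hv hvM huW huM (Ne.symm huv) ha hb haM hbM]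

end Counting


/-! ### The double exchange and the induction. -/

section Existence

variable {V K : Type*} [DecidableEq V] [DecidableEq K] {col : V → V → Option K}

lemma card_colorsTo_le_erase_add_one (W : Finset V) (v w : V) :
    (colorsTo col W w).card ≤ (colorsTo col (W.erase v) w).card + 1 := by
  have hsub : colorsTo col W w ⊆ colorsTo col (W.erase v) w ∪ (col w v).toFinset := by
    intro a ha
    obtain ⟨u, hu, hc⟩ := mem_colorsTo.1 ha
    by_cases huv : u = v
    · subst huv; simp [hc]
    · exact mem_union_left _ (mem_colorsTo.2 ⟨u, mem_erase.2 ⟨huv, hu⟩, hc⟩)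
  refine (card_le_card hsub).trans ((card_union_le _ _).trans (Nat.add_le_add_left ?_ _))
  cases col w v <;> simp

lemma card_colorsTo_lt (hirr : ∀ u, col u u = none) {W : Finset V} {v : V} (hv : v ∈ W) :
    (colorsTo col W v).card < W.card := by
  have hsub : colorsTo col W v ⊆ colorsTo col (W.erase v) v := by
    intro a ha
    obtain ⟨u, hu, hc⟩ := mem_colorsTo.1 ha
    refine mem_colorsTo.2 ⟨u, mem_erase.2 ⟨?_, hu⟩, hc⟩
    rintro rfl
    simp [hirr] at hc
  exact ((card_le_card hsub).trans card_colorsTo_le).trans_lt (card_erase_lt_of_mem hv)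

/-- Outside the case of four vertices, a rainbow matching that misses a vertex of maximum color degree
is not largest possible if the color degrees in `W` have average at least `2 * M.card + 1`. -/
lemma IsRainbow.exists_larger (hsymm : ∀ u w, col u w = col w u) (hirr : ∀ u, col u u = none)
    {W : Finset V} {M : Finset (V × V × K)} (h : IsRainbow col W M) (hM : 1 ≤ M.card)
    (hW : 4 * M.card ≤ W.card) (hW' : M.card = 1 → W.card ≠ 4)
    (hsum : (2 * M.card + 1) * W.card ≤ ∑ w ∈ W, (colorsTo col W w).card)
    {v : V} (hv : v ∈ W) (hvM : v ∉ endpoints M)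
    (hmax : ∀ w ∈ W, (colorsTo col W w).card ≤ (colorsTo col W v).card) :
    ∃ N, IsRainbow col W N ∧ N.card = M.card + 1 := by
  by_contra! hno
  obtain ⟨hWc, hdv, hd, hfree, hpart⟩ := h.sharp_of_maximal hsymm hirr hno hM hW hsum hv hvM hmax
  have hM2 : 2 ≤ M.card := by
    by_contra hlt
    have h1 : M.card = 1 := by omega
    exact hW' h1 (by omega)
  obtain ⟨e, he, f, hf, hef⟩ := one_lt_card.1 hM2
  have hxM : e.1 ∈ endpoints M := mem_endpoints.2 ⟨e, he, .inl rfl⟩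
  have hyM : e.2.1 ∈ endpoints M := mem_endpoints.2 ⟨e, he, .inr rfl⟩
  have hsub : M.erase e ⊆ M := erase_subset _ _
  obtain ⟨c, hc, hcM⟩ := hfree _ hxM
  obtain ⟨u, hu, huM, huv, hyu⟩ := hpart e he
  rw [hc] at hyu
  -- first exchange: `e` is replaced by `{e.2.1, u}`
  have hcM' : c ∉ edgeColors (M.erase e) := fun h => hcM (edgeColors_mono hsub h)
  have hM' := (h.subset hsub).insert_edge (h.right_mem e he) hu (h.notMem_endpoints_erase he).2
    (fun h => huM (endpoints_mono hsub h)) hyu hcM'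
  have hcard : (insert (e.2.1, u, c) (M.erase e)).card = M.card := by
    rw [card_insert_of_notMem_edgeColors hcM', card_erase_add_one he]
  set M' := insert (e.2.1, u, c) (M.erase e) with hM'def
  have hxM' : e.1 ∉ endpoints M' := by
    rw [hM'def, endpoints_insert, mem_union, mem_insert, mem_singleton]
    rintro ((h1 | h1) | h1)
    · exact h.left_ne_right hirr he h1
    · exact huM (h1 ▸ hxM)
    · exact (h.notMem_endpoints_erase he).1 h1
  have hvM' : v ∉ endpoints M' := by
    rw [hM'def, endpoints_insert, mem_union, mem_insert, mem_singleton]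
    rintro ((h1 | h1) | h1)
    · exact hvM (h1 ▸ hyM)
    · exact huv h1.symm
    · exact hvM (endpoints_mono hsub h1)
  have hfM' : f ∈ M' := mem_insert_of_mem (mem_erase.2 ⟨hef.symm, hf⟩)
  -- The vertex `e.1`, now uncovered, also has the maximum color degree `3 * M.card`, so it can play
  -- the role of `v`.
  obtain ⟨-, -, -, hfree', -⟩ := hM'.sharp_of_maximal hsymm hirr (by rwa [hcard])
    (by omega) (by omega) (by rwa [hcard]) (h.left_mem e he) hxM'
    (by rw [hd _ hxM, ← hdv]; exact hmax)
  obtain ⟨g, hg, hgM⟩ := hfree' f.1 (mem_endpoints.2 ⟨f, hfM', .inl rfl⟩)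
  -- second exchange: `f` is replaced by `{e.1, f.1}`
  have hsub' : M'.erase f ⊆ M' := erase_subset _ _
  have hgM' : g ∉ edgeColors (M'.erase f) := fun h => hgM (edgeColors_mono hsub' h)
  have hM'' := (hM'.subset hsub').insert_edge (h.left_mem e he) (hM'.left_mem f hfM')
    (fun h => hxM' (endpoints_mono hsub' h)) (hM'.notMem_endpoints_erase hfM').1 hg hgM'
  have hcard' : (insert (e.1, f.1, g) (M'.erase f)).card = M.card := by
    rw [card_insert_of_notMem_edgeColors hgM', card_erase_add_one hfM', hcard]
  have hvM'' : v ∉ endpoints (insert (e.1, f.1, g) (M'.erase f)) := by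
    rw [endpoints_insert, mem_union, mem_insert, mem_singleton]
    rintro ((h1 | h1) | h1)
    · exact hvM (h1 ▸ hxM)
    · exact hvM (h1 ▸ mem_endpoints.2 ⟨f, hf, .inl rfl⟩)
    · exact hvM' (endpoints_mono hsub' h1)
  obtain ⟨-, -, -, hfree'', -⟩ := hM''.sharp_of_maximal hsymm hirr (by rwa [hcard'])
    (by omega) (by omega) (by rwa [hcard']) hv hvM'' hmax
  obtain ⟨c', hc', hc'M⟩ := hfree'' e.1 (mem_endpoints.2 ⟨_, mem_insert_self _ _, .inl rfl⟩)
  obtain rfl : c = c' := Option.some.inj (hc.symm.trans hc')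
  -- The color `c` of the edge from `v` to `e.1` should be free, but the edge `{e.2.1, u}` of color
  -- `c` survived the second exchange: it is not `f`, as `M` does not cover `u`.
  refine hc'M (mem_edgeColors.2 ⟨(e.2.1, u, c), mem_insert_of_mem (mem_erase.2
    ⟨fun h1 => huM ?_, mem_insert_self _ _⟩), rfl⟩)
  exact mem_endpoints.2 ⟨f, hf, .inr (by rw [← h1])⟩

/-- If the color degrees in `W` have average at least `2 * m + 1` and `W` has at least `4 * m`
vertices, then there is a rainbow matching of size `m + 1`, outside the case of four vertices. -/
theorem exists_isRainbow (hsymm : ∀ u w, col u w = col w u) (hirr : ∀ u, col u u = none) (m : ℕ) :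
    ∀ W : Finset V, W.Nonempty → 4 * m ≤ W.card → (m = 1 → W.card ≠ 4) →
      (2 * m + 1) * W.card ≤ ∑ w ∈ W, (colorsTo col W w).card →
      ∃ M, IsRainbow col W M ∧ M.card = m + 1 := by
  induction m with
  | zero =>
    intro W hW _ _ hsum
    obtain ⟨v, hv, hne⟩ : ∃ v ∈ W, (colorsTo col W v).card ≠ 0 := by
      apply exists_ne_zero_of_sum_ne_zero
      have := hW.card_pos
      omega
    obtain ⟨a, ha⟩ := card_ne_zero.1 hne
    obtain ⟨w, hw, hc⟩ := mem_colorsTo.1 ha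
    have hempty : IsRainbow col W (∅ : Finset (V × V × K)) := by constructor <;> simp
    exact ⟨_, hempty.insert_edge hv hw (by simp [endpoints]) (by simp [endpoints]) hc
      (by simp [edgeColors]), rfl⟩
  | succ m ih =>
    intro W hW hcard hne hsum
    obtain ⟨v, hv, hmax⟩ := exists_max_image W (fun w => (colorsTo col W w).card) hW
    have hcv := card_erase_add_one hv
    -- The case of four vertices cannot recur, since `m = 1` gives `W` at least eight. Deleting `v`
    -- costs its own color degree and at most one at each other vertex, at most `2 * (W.card - 1)`
    -- in total.
    obtain ⟨M, hM, hMc⟩ := ih (W.erase v) (card_pos.1 (by omega)) (by omega)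
      (by intro h1; omega) (by
        have h1 := sum_le_sum fun w (_ : w ∈ W.erase v) =>
          card_colorsTo_le_erase_add_one (col := col) W v w
        rw [sum_add_distrib, sum_const, smul_eq_mul] at h1
        rw [← add_sum_erase _ _ hv] at hsum
        have h2 := card_colorsTo_lt hirr hv
        rw [← hcv] at hsum h2
        nlinarith)
    have hvM : v ∉ endpoints M := fun h => notMem_erase v W (hM.endpoints_subset h)
    have hM' := hM.mono (erase_subset v W)
    rw [← hMc] at hcard hne hsum ⊢
    exact hM'.exists_larger hsymm hirr (by omega) hcard hne hsum hv hvM hmax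

end Existence

/-! ### Translation to edge-colored graphs, and the exceptional `K4`. -/

section EdgeColoring

variable {V K : Type*} {G : SimpleGraph V}

open Classical in
/-- The edge coloring `C` as a partial function on pairs of vertices. -/
noncomputable def pairColor (C : G.edgeSet → K) (u w : V) : Option K :=
  if h : G.Adj u w then some (C ⟨s(u, w), h⟩) else none

variable {C : G.edgeSet → K} {u v w : V} {a : K}

lemma pairColor_eq_some :
    pairColor C u w = some a ↔ ∃ h : G.Adj u w, C ⟨s(u, w), h⟩ = a := by
  unfold pairColor; split_ifs with h <;> simp [h]

lemma pairColor_symm (u w : V) : pairColor C u w = pairColor C w u := by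
  ext a
  simp only [pairColor_eq_some]
  constructor <;> rintro ⟨h, rfl⟩ <;> exact ⟨h.symm, by congr 2; exact Sym2.eq_swap⟩

lemma pairColor_self (u : V) : pairColor C u u = none := by
  simp [pairColor]

variable [Fintype V] [DecidableEq V] [DecidableEq K]

lemma colorDegree_eq_card (v : V) :
    colorDegree C v = (colorsTo (pairColor C) univ v).card := by
  rw [colorDegree, ← Set.ncard_coe_finset]
  congr 1
  ext a
  simp only [Set.mem_image, Set.mem_ofPred_eq, mem_coe, mem_colorsTo, mem_univ, true_and,
    pairColor_eq_some]
  constructor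
  · rintro ⟨⟨e, he⟩, hv, rfl⟩
    obtain ⟨w, rfl⟩ := Sym2.mem_iff_exists.1 hv
    exact ⟨w, he, rfl⟩
  · rintro ⟨w, h, rfl⟩
    exact ⟨⟨s(v, w), h⟩, Sym2.mem_mk_left v w, rfl⟩

lemma IsRainbow.exists_isRainbowMatching {M : Finset (V × V × K)}
    (h : IsRainbow (pairColor C) univ M) :
    ∃ H : G.Subgraph, IsRainbowMatching C H ∧ H.edgeSet.ncard = M.card := by
  have hadj : ∀ e ∈ M, ∃ h : G.Adj e.1 e.2.1, C ⟨s(e.1, e.2.1), h⟩ = e.2.2 := fun e he =>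
    pairColor_eq_some.1 (h.col_eq e he)
  have hdisj : ∀ e ∈ M, ∀ f ∈ M, ∀ w, (w = e.1 ∨ w = e.2.1) → (w = f.1 ∨ w = f.2.1) → e = f := by
    intro e he f hf w hwe hwf
    by_contra hef
    exact disjoint_left.1 (h.ends_disjoint e he f hf hef) (by simpa using hwe) (by simpa using hwf)
  let H : G.Subgraph :=
    { verts := {w | ∃ e ∈ M, w = e.1 ∨ w = e.2.1}
      Adj := fun u w => ∃ e ∈ M, (u = e.1 ∧ w = e.2.1) ∨ (u = e.2.1 ∧ w = e.1)
      adj_sub := by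
        rintro u w ⟨e, he, ⟨rfl, rfl⟩ | ⟨rfl, rfl⟩⟩
        exacts [(hadj e he).1, (hadj e he).1.symm]
      edge_vert := by
        rintro u w ⟨e, he, ⟨rfl, rfl⟩ | ⟨rfl, rfl⟩⟩
        exacts [⟨e, he, .inl rfl⟩, ⟨e, he, .inr rfl⟩]
      symm := ⟨by
        rintro u w ⟨e, he, h | h⟩
        exacts [⟨e, he, .inr h.symm⟩, ⟨e, he, .inl h.symm⟩]⟩ }
  have hedge : H.edgeSet = (fun e : V × V × K => s(e.1, e.2.1)) '' (M : Set (V × V × K)) := by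
    ext z
    induction z with
    | h u w =>
      simp only [SimpleGraph.Subgraph.mem_edgeSet, Set.mem_image, mem_coe, H, Sym2.eq_iff]
      exact exists_congr fun e => and_congr_right fun _ => by
        simp only [eq_comm, and_comm]
  refine ⟨H, ⟨?_, ?_⟩, ?_⟩
  · rintro w ⟨e, he, rfl | rfl⟩
    · refine ⟨e.2.1, ⟨e, he, .inl ⟨rfl, rfl⟩⟩, ?_⟩
      rintro u ⟨f, hf, ⟨h1, rfl⟩ | ⟨h1, rfl⟩⟩
      · rw [hdisj e he f hf e.1 (.inl rfl) (.inl h1)]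
      · obtain rfl := hdisj e he f hf e.1 (.inl rfl) (.inr h1)
        exact h1
    · refine ⟨e.1, ⟨e, he, .inr ⟨rfl, rfl⟩⟩, ?_⟩
      rintro u ⟨f, hf, ⟨h1, rfl⟩ | ⟨h1, rfl⟩⟩
      · obtain rfl := hdisj e he f hf e.2.1 (.inr rfl) (.inl h1)
        exact h1
      · rw [hdisj e he f hf e.2.1 (.inr rfl) (.inr h1)]
  · rintro ⟨z, hz⟩ ⟨z', hz'⟩ hzH hz'H hC
    simp only [hedge] at hzH hz'H
    obtain ⟨e, he, rfl⟩ := hzH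
    obtain ⟨f, hf, rfl⟩ := hz'H
    obtain ⟨_, h1⟩ := hadj e he
    obtain ⟨_, h2⟩ := hadj f hf
    obtain rfl := h.color_inj e he f hf (h1.symm.trans (hC.trans h2))
    rfl
  · rw [hedge, Set.InjOn.ncard_image, Set.ncard_coe_finset]
    intro e he f hf hef
    refine hdisj e he f hf e.1 (.inl rfl) ?_
    have : e.1 ∈ s(f.1, f.2.1) := by
      rw [← show s(e.1, e.2.1) = s(f.1, f.2.1) from hef]; exact Sym2.mem_mk_left _ _
    simpa using this

lemma isTildeK4_of_forall_card_ne_two (hV : Fintype.card V = 4)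
    (hsum : 12 ≤ ∑ v : V, (colorsTo (pairColor C) univ v).card)
    (hno : ∀ N, IsRainbow (pairColor C) univ N → N.card ≠ 2) : IsTildeK4 C := by
  have hle : ∀ v ∈ (univ : Finset V), (colorsTo (pairColor C) univ v).card ≤ 3 := fun v hv => by
    have := card_colorsTo_lt (pairColor_self (C := C)) hv
    rw [card_univ, hV] at this
    omega
  -- Four color degrees, each at most 3, sum to at least 12.
  have hdeg : ∀ v : V, (colorsTo (pairColor C) univ v).card = 3 := fun v =>
    (sum_eq_sum_iff_of_le hle).1 (le_antisymm (sum_le_sum hle) (by simpa [hV] using hsum)) v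
      (mem_univ v)
  -- Three colors at `v` need all three other vertices. This yields completeness (the inner claim is
  -- vacuous for a non-edge) and properness.
  have hkey : ∀ v w : V, v ≠ w → ¬ ∀ a, pairColor C v w = some a →
      ∃ u, u ≠ w ∧ pairColor C v u = some a := by
    intro v w hvw hcon
    have hsub : colorsTo (pairColor C) univ v ⊆
        colorsTo (pairColor C) ((univ.erase v).erase w) v := by
      intro a ha
      obtain ⟨u, -, hu⟩ := mem_colorsTo.1 ha
      have hv : ∀ u, pairColor C v u = some a → u ≠ v := by
        rintro u hu rfl
        simp [pairColor_self] at hu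
      by_cases huw : u = w
      · subst huw
        obtain ⟨u', hu', hc⟩ := hcon a hu
        exact mem_colorsTo.2 ⟨u', by simp [hu', hv u' hc], hc⟩
      · exact mem_colorsTo.2 ⟨u, by simp [huw, hv u hu], hu⟩
    have := (card_le_card hsub).trans card_colorsTo_le
    rw [hdeg, card_erase_of_mem (by simp [hvw.symm]), card_erase_of_mem (mem_univ v), card_univ,
      hV] at this
    omega
  have htop : ∀ v w : V, v ≠ w → G.Adj v w := by
    intro v w hvw
    by_contra hadj
    exact hkey v w hvw fun a ha => absurd (pairColor_eq_some.1 ha).1 hadj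
  have hproper : IsProper C := by
    rintro ⟨e, he⟩ ⟨f, hf⟩ v hef hve hvf hC
    obtain ⟨w, rfl⟩ := Sym2.mem_iff_exists.1 hve
    obtain ⟨u, rfl⟩ := Sym2.mem_iff_exists.1 hvf
    refine hkey v w (G.ne_of_adj he) fun a ha => ⟨u, ?_, ?_⟩
    · rintro rfl
      exact hef rfl
    · obtain ⟨_, rfl⟩ := pairColor_eq_some.1 ha
      exact pairColor_eq_some.2 ⟨hf, hC.symm⟩
  refine ⟨by rw [Nat.card_eq_fintype_card, hV], ?_, hproper, ?_⟩
  · ext v w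
    exact ⟨fun h => G.ne_of_adj h, fun h => htop v w h⟩
  rintro ⟨e, he⟩
  induction e with
  | h x y =>
    have hxy : x ≠ y := G.ne_of_adj he
    have hcard : (univ \ {x, y} : Finset V).card = 2 := by
      rw [card_sdiff_of_subset (subset_univ _), card_univ, hV, card_pair hxy]
    obtain ⟨z, t, hzt, hzt'⟩ := card_eq_two.1 hcard
    have hmem : ∀ w, w ≠ x → w ≠ y → w = z ∨ w = t := by
      intro w hx hy
      have : w ∈ univ \ {x, y} := by simp [hx, hy]
      simpa [hzt'] using this
    have hz : z ∈ (univ \ {x, y} : Finset V) := by simp [hzt']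
    have ht : t ∈ (univ \ {x, y} : Finset V) := by simp [hzt']
    simp only [mem_sdiff, mem_univ, true_and, mem_insert, mem_singleton, not_or] at hz ht
    have hadj := htop z t hzt
    -- Complementary edges of different colors would form a rainbow matching of size 2.
    have hsame : C ⟨s(z, t), hadj⟩ = C ⟨s(x, y), he⟩ := by
      by_contra hne
      have hempty : IsRainbow (pairColor C) univ (∅ : Finset (V × V × K)) := by
        constructor <;> simp
      have h1 := hempty.insert_edge (mem_univ x) (mem_univ y) (by simp [endpoints])
        (by simp [endpoints]) (pairColor_eq_some.2 ⟨he, rfl⟩) (by simp [edgeColors])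
      have hc : C ⟨s(z, t), hadj⟩ ∉
          edgeColors (insert (x, y, C ⟨s(x, y), he⟩) (∅ : Finset (V × V × K))) := by
        simpa [edgeColors] using hne
      exact hno _ (h1.insert_edge (mem_univ z) (mem_univ t) (by simp [endpoints, hz])
        (by simp [endpoints, ht]) (pairColor_eq_some.2 ⟨hadj, rfl⟩) hc)
        (card_insert_of_notMem_edgeColors hc)
    have hset : {f : G.edgeSet | C f = C ⟨s(x, y), he⟩} = {⟨s(x, y), he⟩, ⟨s(z, t), hadj⟩} := by
      ext f
      simp only [Set.mem_ofPred_eq, Set.mem_insert_iff, Set.mem_singleton_iff]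
      refine ⟨fun hf => ?_, ?_⟩
      · by_contra! hcon
        have hfx : x ∉ (f : Sym2 V) := fun h =>
          hproper f ⟨s(x, y), he⟩ x hcon.1 h (Sym2.mem_mk_left _ _) hf
        have hfy : y ∉ (f : Sym2 V) := fun h =>
          hproper f ⟨s(x, y), he⟩ y hcon.1 h (Sym2.mem_mk_right _ _) hf
        obtain ⟨f, hfG⟩ := f
        induction f with
        | h p q =>
          have hpq : p ≠ q := G.ne_of_adj hfG
          simp only [Sym2.mem_iff, not_or] at hfx hfy
          apply hcon.2
          rcases hmem p (Ne.symm hfx.1) (Ne.symm hfy.1) with rfl | rfl <;>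
            rcases hmem q (Ne.symm hfx.2) (Ne.symm hfy.2) with rfl | rfl
          · exact absurd rfl hpq
          · rfl
          · exact Subtype.ext Sym2.eq_swap
          · exact absurd rfl hpq
      · rintro (rfl | rfl)
        exacts [rfl, hsame]
    rw [hset, Set.ncard_pair]
    intro heq
    have : z ∈ s(x, y) := by
      rw [Subtype.mk.inj heq]; exact Sym2.mem_mk_left _ _
    simp [hz] at this

end EdgeColoring

end EdgeColored

theorem mainTheorem1 {V : Type*} [Fintype V] {K : Type*} (G : SimpleGraph V)
    (C : G.edgeSet → K) (k : ℕ) (hk : 1 ≤ k)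
    (hG : ¬ EdgeColored.IsTildeK4 C)
    (havg : 2 * (k : ℚ) - 1 ≤ EdgeColored.averageColorDegree C)
    (hcard : 4 * k - 4 ≤ Fintype.card V) :
    ∃ M : G.Subgraph, EdgeColored.IsRainbowMatching C M ∧ M.edgeSet.ncard = k := by
  classical
  obtain ⟨m, rfl⟩ : ∃ m, k = m + 1 := ⟨k - 1, by omega⟩
  -- The average over an empty vertex set is 0 by division by zero, below `2 * m + 1`.
  have hpos : 0 < Fintype.card V := by
    rw [Nat.pos_iff_ne_zero]
    intro h0
    rw [EdgeColored.averageColorDegree, h0] at havg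
    have : (0 : ℚ) ≤ m := Nat.cast_nonneg m
    push_cast at havg
    rw [div_zero] at havg
    linarith
  have hsum : (2 * m + 1) * (Finset.univ : Finset V).card ≤
      ∑ v, (EdgeColored.colorsTo (EdgeColored.pairColor C) Finset.univ v).card := by
    rw [EdgeColored.averageColorDegree, le_div_iff₀ (by exact_mod_cast hpos)] at havg
    simp only [EdgeColored.colorDegree_eq_card] at havg
    rw [Finset.card_univ]
    have : (2 * ((m + 1 : ℕ) : ℚ) - 1) = ((2 * m + 1 : ℕ) : ℚ) := by push_cast; ring
    rw [this] at havg
    exact_mod_cast havg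
  suffices h : ∃ M, EdgeColored.IsRainbow (EdgeColored.pairColor C) Finset.univ M ∧
      M.card = m + 1 by
    obtain ⟨M, hM, hMc⟩ := h
    rw [← hMc]
    exact hM.exists_isRainbowMatching
  by_cases h4 : m = 1 ∧ Fintype.card V = 4
  · obtain ⟨rfl, h4⟩ := h4
    by_contra! hno
    rw [Finset.card_univ, h4] at hsum
    exact hG (EdgeColored.isTildeK4_of_forall_card_ne_two h4 (by omega) hno)
  · refine EdgeColored.exists_isRainbow EdgeColored.pairColor_symm EdgeColored.pairColor_self m _
      (Finset.card_pos.1 ?_) ?_ ?_ hsum <;> rw [Finset.card_univ]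
    · exact hpos
    · omega
    · tauto
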